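/- Let $d \ge 2$ be an integer and let $S$ be a semigroup with identity $1$ (a monoid) which is $d$-generated, i.e. generated as a monoid by a finite set $T \subseteq S$ with $|T| \le d$. Suppose that $S$ has no finite right ideals, where a right ideal is a nonempty subset $I \subseteq S$ with $IS \subseteq I$. Let $\operatorname{Cay}(S,T)$ be the directed graph with vertex set $S$ and edges $(a, at)$ for $a \in S$, $t \in T$, let $\operatorname{dist}$ denote the directed distance in it, and write $|a| = \operatorname{dist}(1,a)$ for $a \in S$. For real $r \ge 0$ define \[ F_S(r) = \min_{v \in S}\ \max_{w \,:\, \operatorname{dist}(v,w) \le r} |w| . \] Let $(R_n)_{n \ge 0}$ be a simple right random walk on $S$ with respect to $T$, i.e. $R_0 = 1$ and $R_n = X_1 X_2 \cdots X_n$, where $X_1, X_2, \dots$ are independent random variables, each uniformly distributed on $T$. Then, almost surely, \[ |R_n| \ge F_S\bigl(\log_d n + \log_d \log_d n\bigr) \quad \text{for infinitely many } n . \] -/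

import Mathlib

open MeasureTheory ProbabilityTheory Filter

namespace RootedBallSpread

section Digraph

variable {V : Type*}

/-- `HasWalk G k v w`: the directed graph `G` has a directed walk with exactly `k` edges
from `v` to `w`. -/
inductive HasWalk (G : Digraph V) : ℕ → V → V → Prop
  | nil (v : V) : HasWalk G 0 v v
  | snoc {k : ℕ} {u v w : V} (p : HasWalk G k u v) (h : G.Adj v w) : HasWalk G (k + 1) u w

/-- The directed distance from `v` to `w`: the least length of a directed walk from `v` to `w`
(it is `⊤` if there is none). -/
noncomputable def dist (G : Digraph V) (v w : V) : ℕ∞ :=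
  ⨅ (k : ℕ) (_ : HasWalk G k v w), (k : ℕ∞)

/-- The (out-)ball of real radius `r` around `v`: the vertices `w` with `dist v w ≤ r`, that is,
`dist v w ≤ k` for some natural number `k ≤ r`. -/
def ball (G : Digraph V) (v : V) (r : ℝ) : Set V :=
  {w | ∃ k : ℕ, (k : ℝ) ≤ r ∧ dist G v w ≤ (k : ℕ∞)}

/-- The largest distance from the root `o` of a vertex in the ball of radius `r` around `v`.
In a graph with finite out-degrees and `0 ≤ r` the ball is finite and nonempty, so the supremum
is a maximum. -/
noncomputable def spreadAt (G : Digraph V) (o v : V) (r : ℝ) : ℕ∞ :=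
  ⨆ w ∈ ball G v r, dist G o w

/-- The rooted ball spread of the directed graph `G` with root `o`: the minimum over all vertices
`v` of `spreadAt G o v r` (an infimum in `ℕ∞` of a nonempty family is attained). -/
noncomputable def spread (G : Digraph V) (o : V) (r : ℝ) : ℕ∞ :=
  ⨅ v : V, spreadAt G o v r

end Digraph

section Monoid

variable {S : Type*} [Monoid S]

/-- The (right) Cayley graph of the monoid `S` with respect to `T`: the edges are the pairs
`(a, a * t)` with `a ∈ S` and `t ∈ T`. -/
def cayleyDigraph (T : Finset S) : Digraph S where
  Adj a b := ∃ t ∈ T, b = a * t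

/-- The word length `|a|` of `a ∈ S`: the distance from `1` to `a` in the Cayley graph. -/
noncomputable def wordLength (T : Finset S) (a : S) : ℕ∞ :=
  dist (cayleyDigraph T) 1 a

/-- The function `F_S`: the rooted ball spread of the Cayley graph of `S` with root `1`. -/
noncomputable def semigroupSpread (T : Finset S) (r : ℝ) : ℕ∞ :=
  spread (cayleyDigraph T) 1 r

/-- `I` is a right ideal of `S`: a nonempty subset with `I S ⊆ I`. -/
structure IsRightIdeal (I : Set S) : Prop where
  nonempty : I.Nonempty
  mul_mem : ∀ a ∈ I, ∀ s : S, a * s ∈ I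

/-- `R` is a simple right random walk on `S` with respect to `T`:
`R n = X 0 * X 1 * ⋯ * X (n - 1)`, where `X 0, X 1, …` are independent random elements of `S`,
each of them uniformly distributed on `T`. -/
def IsSimpleRightRandomWalk [MeasurableSpace S] {Ω : Type*} [MeasurableSpace Ω]
    (T : Finset S) (μ : Measure Ω) (R : ℕ → Ω → S) : Prop :=
  ∃ X : ℕ → Ω → S,
    (∀ i, Measurable (X i)) ∧
    iIndepFun X μ ∧
    (∀ i, μ.map (X i) = uniformOn (T : Set S)) ∧
    (∀ ω, R 0 ω = 1) ∧
    (∀ n ω, R (n + 1) ω = R n ω * X n ω)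

end Monoid

end RootedBallSpread

/-! Let `A k` be the set of elements of length at least `F_S(k)`. By the definition of `F_S`, every
vertex reaches `A k` within `k` steps, so `k` prescribed steps in a row succeed with probability at
least `d⁻ᵏ`. A wrong step only restarts the attempt. Over `2k` steps there are `k` disjoint ways to
succeed after a restart, hence a hit has probability at least `k / (2dᵏ)` from any start
(`avoidProb_two_mul_le`). Give scale `k` a block of about `dᵏ / (8k²)` such windows. By the Markov
property it misses `A k` with conditional probability at most `exp(-1/(32k))`, and divergence of the
harmonic series forces infinitely many hits (`ae_frequently_hit`). The blocks are short enough that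
a hit at time `n` in block `k` has `n(k+1) ≤ dᵏ⁺¹`, whence `log_d n + log_d log_d n < k + 1`; as
balls see only the integer part of the radius, the hit has the required length. -/

namespace RootedBallSpread

/-! ### Directed walks and finite balls -/

section Digraph

variable {V : Type*} {G : Digraph V}

theorem HasWalk.exists_cons {k : ℕ} {v w : V} (h : HasWalk G (k + 1) v w) :
    ∃ u, G.Adj v u ∧ HasWalk G k u w := by
  induction k generalizing w with
  | zero =>
    cases h with
    | snoc p h => cases p; exact ⟨w, h, .nil w⟩
  | succ k ih =>
    cases h with
    | snoc p h =>
      obtain ⟨u, hu, hw⟩ := ih p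
      exact ⟨u, hu, .snoc hw h⟩

theorem exists_hasWalk_of_dist_le {v w : V} {k : ℕ} (h : dist G v w ≤ k) :
    ∃ j ≤ k, HasWalk G j v w := by
  have h' : dist G v w < ((k + 1 : ℕ) : ℕ∞) :=
    lt_of_le_of_lt h (by exact_mod_cast Nat.lt_succ_self k)
  simp only [dist, iInf_lt_iff] at h'
  obtain ⟨j, hj, hlt⟩ := h'
  exact ⟨j, Nat.lt_succ_iff.1 (by exact_mod_cast hlt), hj⟩

theorem dist_self (v : V) : dist G v v = 0 :=
  le_antisymm (iInf₂_le_of_le 0 (.nil v) (by simp)) bot_le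

theorem finite_setOf_hasWalk (hG : ∀ v, {w | G.Adj v w}.Finite) (k : ℕ) (v : V) :
    {w | HasWalk G k v w}.Finite := by
  induction k with
  | zero =>
    refine (Set.finite_singleton v).subset ?_
    intro w hw
    cases hw; rfl
  | succ k ih =>
    refine (ih.biUnion fun u _ => hG u).subset ?_
    intro w hw
    cases hw with
    | snoc p h => exact Set.mem_biUnion (Set.mem_ofPred.2 p) h

theorem finite_ball (hG : ∀ v, {w | G.Adj v w}.Finite) (v : V) (r : ℝ) :
    (ball G v r).Finite := by
  refine ((Set.finite_Iic ⌊r⌋₊).biUnion fun j _ => finite_setOf_hasWalk hG j v).subset ?_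
  rintro w ⟨k, hk, hw⟩
  obtain ⟨j, hj, hw⟩ := exists_hasWalk_of_dist_le hw
  exact Set.mem_biUnion (Set.mem_Iic.2 (hj.trans (Nat.le_floor hk))) hw

theorem exists_hasWalk_spread_le (hG : ∀ v, {w | G.Adj v w}.Finite) (o v : V) (k : ℕ) :
    ∃ w, spread G o k ≤ dist G o w ∧ ∃ j ≤ k, HasWalk G j v w := by
  have hne : (ball G v k).Nonempty := ⟨v, k, le_rfl, by simp [dist_self]⟩
  have hmem := (hne.image (dist G o)).csSup_mem ((finite_ball hG v k).image _)
  obtain ⟨w, ⟨i, hi, hw⟩, hwe⟩ := hmem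
  obtain ⟨j, hj, hw⟩ := exists_hasWalk_of_dist_le hw
  refine ⟨w, ?_, j, hj.trans (by exact_mod_cast hi), hw⟩
  rw [hwe, sSup_image]
  exact iInf_le _ v

/-- Distances are integers, so rounding the radius down loses nothing. -/
theorem spread_le_of_lt_add_one (o : V) {r : ℝ} {k : ℕ} (h : r < k + 1) :
    spread G o r ≤ spread G o k := by
  refine iInf_mono fun v => biSup_mono ?_
  rintro w ⟨j, hj, hw⟩
  have : j ≤ k := Nat.lt_succ_iff.1 (by exact_mod_cast lt_of_le_of_lt hj h)
  exact ⟨j, by exact_mod_cast this, hw⟩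

end Digraph

/-! ### Avoidance probabilities -/

section AvoidProb

variable {S : Type*} [Monoid S]

open Classical in
/-- The probability that the simple right random walk started at `v` avoids `A` at all times
`0, …, L`. -/
noncomputable def avoidProb (T : Finset S) (A : Set S) : ℕ → S → ℝ
  | 0, v => if v ∈ A then 0 else 1
  | L + 1, v => if v ∈ A then 0 else (T.card : ℝ)⁻¹ * ∑ t ∈ T, avoidProb T A L (v * t)

variable {T : Finset S} {A : Set S}

theorem avoidProb_of_mem {v : S} (h : v ∈ A) (L : ℕ) : avoidProb T A L v = 0 := by
  cases L <;> simp [avoidProb, h]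

theorem avoidProb_zero_of_notMem {v : S} (h : v ∉ A) : avoidProb T A 0 v = 1 := by
  simp [avoidProb, h]

theorem avoidProb_succ_of_notMem {v : S} (h : v ∉ A) (L : ℕ) :
    avoidProb T A (L + 1) v = (T.card : ℝ)⁻¹ * ∑ t ∈ T, avoidProb T A L (v * t) := by
  simp [avoidProb, h]

theorem avoidProb_nonneg (L : ℕ) (v : S) : 0 ≤ avoidProb T A L v := by
  induction L generalizing v with
  | zero => unfold avoidProb; split_ifs <;> simp
  | succ L ih =>
    unfold avoidProb
    split_ifs
    · exact le_rfl
    · exact mul_nonneg (by positivity) (Finset.sum_nonneg fun t _ => ih _)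

theorem avoidProb_add_le {c : ℝ} {L' : ℕ} (hc : ∀ v, avoidProb T A L' v ≤ c) (L : ℕ) (v : S) :
    avoidProb T A (L + L') v ≤ c * avoidProb T A L v := by
  induction L generalizing v with
  | zero =>
    by_cases h : v ∈ A
    · simp [avoidProb_of_mem h]
    · simpa [avoidProb_zero_of_notMem h] using hc v
  | succ L ih =>
    by_cases h : v ∈ A
    · simp [avoidProb_of_mem h]
    · rw [Nat.add_right_comm, avoidProb_succ_of_notMem h, avoidProb_succ_of_notMem h,
        mul_left_comm, Finset.mul_sum _ _ c]
      gcongr with t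
      exact ih _

theorem avoidProb_mul_le {c : ℝ} {L : ℕ} (hc : ∀ v, avoidProb T A L v ≤ c) (M : ℕ) (v : S) :
    avoidProb T A (L * M) v ≤ c ^ M := by
  have hc0 : 0 ≤ c := (avoidProb_nonneg L v).trans (hc v)
  induction M with
  | zero =>
    by_cases h : v ∈ A
    · simp [avoidProb_of_mem h]
    · simp [avoidProb_zero_of_notMem h]
  | succ M ih =>
    rw [Nat.mul_succ, pow_succ']
    exact (avoidProb_add_le hc _ v).trans (by gcongr)

/-- The terms are probabilities of disjoint events: `D` good steps at once, or a failure at one of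
the first `min D m` steps followed by `k` good ones. This keeps the bound of `avoidProb_le`
nonnegative when the start is already in `A`. -/
theorem pow_add_mul_min_le_one {p : ℝ} (h0 : 0 < p) (h1 : p ≤ 1) {D k : ℕ} (hD : D ≤ k) (m : ℕ) :
    p ^ D + (1 - p) * p ^ k * (min D m : ℕ) ≤ 1 := by
  have h2 : p ^ D * (1 + (1 - p) * D) ≤ 1 := by
    induction D with
    | zero => simp
    | succ D ih =>
      have ih := ih (by omega)
      have : p ^ D ≤ 1 := pow_le_one₀ h0.le h1
      have h3 : p * (p ^ D * (1 + (1 - p) * D)) ≤ p := by nlinarith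
      have h4 : p * (1 - p) * p ^ D ≤ (1 - p) * 1 := by
        rw [mul_comm p, mul_assoc, ← pow_succ']
        exact mul_le_mul_of_nonneg_left (pow_le_one₀ h0.le h1) (by linarith)
      rw [pow_succ]; push_cast; nlinarith
  have h3 : (1 - p) * p ^ k * (min D m : ℕ) ≤ (1 - p) * p ^ D * D := by
    have : 0 ≤ 1 - p := by linarith
    gcongr (1 - p) * ?_ * ?_
    · exact pow_le_pow_of_le_one h0.le h1 hD
    · exact_mod_cast min_le_left _ _
  nlinarith

/-- The walk hits `A` as soon as it follows `k` times in a row a step towards `A`; the bound is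
the probability that this happens in `L` steps for a first run that starts at time `0`, or
right after a failure. -/
theorem avoidProb_le {p : ℝ} (hT : T.Nonempty) (hp : p = (T.card : ℝ)⁻¹) {k : ℕ}
    (hA : ∀ v, ∃ w ∈ A, ∃ j ≤ k, HasWalk (cayleyDigraph T) j v w) (L : ℕ) {D : ℕ} (hD : D ≤ k)
    {v : S} (hv : ∃ w ∈ A, ∃ j ≤ D, HasWalk (cayleyDigraph T) j v w) :
    avoidProb T A L v ≤
      1 - ((if D ≤ L then p ^ D else 0) + (1 - p) * p ^ k * (min D (L - k) : ℕ)) := by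
  have hc : (1 : ℝ) ≤ T.card := by exact_mod_cast hT.card_pos
  have h0 : 0 < p := by rw [hp]; positivity
  have h1 : p ≤ 1 := by rw [hp]; exact inv_le_one_of_one_le₀ hc
  have hpc : p * T.card = 1 := by rw [hp]; field_simp
  induction L generalizing D v with
  | zero =>
    by_cases h : v ∈ A
    · rw [avoidProb_of_mem h]
      have := pow_add_mul_min_le_one h0 h1 hD (0 - k)
      split_ifs
      · linarith
      · linarith [pow_pos h0 D]
    · rw [avoidProb_zero_of_notMem h]
      have hD0 : ¬ D ≤ 0 := by
        intro hD0
        obtain ⟨w, hw, j, hj, hjw⟩ := hv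
        obtain rfl : j = 0 := by omega
        cases hjw; exact h hw
      simp [hD0]
  | succ L ih =>
    by_cases h : v ∈ A
    · rw [avoidProb_of_mem h]
      have := pow_add_mul_min_le_one h0 h1 hD (L + 1 - k)
      split_ifs
      · linarith
      · linarith [pow_pos h0 D]
    obtain ⟨w, hw, j, hj, hjw⟩ := hv
    obtain _ | j := j
    · cases hjw; exact absurd hw h
    obtain ⟨_, ⟨t, ht, rfl⟩, hjw⟩ := hjw.exists_cons
    obtain ⟨D, rfl⟩ : ∃ D', D = D' + 1 := ⟨D - 1, by omega⟩
    -- The step `t` continues the current run; any other step starts a fresh run of length at most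
    -- `k`.
    have hgood := ih (D := D) (v := v * t) (by omega) ⟨w, hw, j, by omega, hjw⟩
    have hbad := fun u => ih (D := k) (v := u) le_rfl (hA u)
    set b := 1 - ((if k ≤ L then p ^ k else 0) + (1 - p) * p ^ k * (min k (L - k) : ℕ))
    classical
    rw [avoidProb_succ_of_notMem h, ← hp, ← Finset.add_sum_erase _ _ ht]
    have hsum : ∑ s ∈ T.erase t, avoidProb T A L (v * s) ≤ (T.card - 1) * b := by
      refine (Finset.sum_le_card_nsmul _ _ b fun s _ => hbad _).trans (le_of_eq ?_)
      rw [nsmul_eq_mul, Finset.card_erase_of_mem ht, Nat.cast_pred hT.card_pos]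
    have hstep : p * (avoidProb T A L (v * t) + ∑ s ∈ T.erase t, avoidProb T A L (v * s)) ≤
        p * (1 - ((if D ≤ L then p ^ D else 0) + (1 - p) * p ^ k * (min D (L - k) : ℕ))) +
          (1 - p) * b := by
      have : (1 - p) * b = p * ((T.card - 1) * b) := by linear_combination (-b) * hpc
      rw [this, ← mul_add]
      gcongr
    refine hstep.trans ?_
    have hpk := pow_pos h0 k
    have hx : 0 ≤ (1 - p) * p ^ k := mul_nonneg (by linarith) hpk.le
    simp only [b, Nat.add_le_add_iff_right]
    -- If `L < k`, no time is left for a full run after a failure. Otherwise a failure now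
    -- contributes the extra term `(1 - p) * p ^ k`, which raises the `min` by one.
    rcases lt_or_ge L k with hLk | hLk
    · have e1 : L - k = 0 := by omega
      have e2 : L + 1 - k = 0 := by omega
      simp only [e1, e2, not_le.2 hLk, if_false, Nat.min_zero]
      split_ifs
      · rw [pow_succ]; push_cast; nlinarith
      · push_cast; nlinarith
    · have e2 : L + 1 - k = (L - k) + 1 := by omega
      have e3 : min (D + 1) (L - k + 1) = min D (L - k) + 1 := by omega
      have e4 : ((min D (L - k) : ℕ) : ℝ) ≤ (min k (L - k) : ℕ) := by
        exact_mod_cast min_le_min_right _ (by omega)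
      have e5 : (1 - p) * ((1 - p) * p ^ k) * (min D (L - k) : ℕ) ≤
          (1 - p) * ((1 - p) * p ^ k) * (min k (L - k) : ℕ) := by
        have : 0 ≤ 1 - p := by linarith
        gcongr
      rw [e2, e3]
      have e6 : D ≤ L := by omega
      simp only [hLk, e6, if_true]
      rw [pow_succ]; push_cast [-Nat.cast_min]; nlinarith

theorem avoidProb_two_mul_le (hT : T.Nonempty) {d : ℕ} (hd : 2 ≤ d) (hTd : T.card ≤ d) {k : ℕ}
    (hA : ∀ v, ∃ w ∈ A, ∃ j ≤ k, HasWalk (cayleyDigraph T) j v w) (v : S) :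
    avoidProb T A (2 * k) v ≤ 1 - k / (2 * d ^ k) := by
  have h := avoidProb_le hT rfl hA (2 * k) le_rfl (hA v)
  refine h.trans ?_
  have e : 2 * k - k = k := by omega
  rw [e, if_pos (by omega), min_self]
  have hd0 : (0 : ℝ) < d := by exact_mod_cast (by omega : 0 < d)
  have hc : (1 : ℝ) ≤ T.card := by exact_mod_cast hT.card_pos
  have hk : (k : ℝ) ≤ d ^ k := by
    exact_mod_cast (Nat.lt_two_pow_self (n := k)).le.trans (Nat.pow_le_pow_left hd k)
  have key : (k : ℝ) / (2 * d ^ k) ≤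
      (T.card : ℝ)⁻¹ ^ k + (1 - (T.card : ℝ)⁻¹) * (T.card : ℝ)⁻¹ ^ k * k := by
    rcases Nat.lt_or_ge 1 T.card with h1 | h1
    · have h2 : (2 : ℝ) ≤ T.card := by exact_mod_cast h1
      have h3 : (T.card : ℝ)⁻¹ ≤ 1 / 2 := by
        rw [one_div]; exact inv_anti₀ (by norm_num) h2
      have h4 : ((d : ℝ) ^ k)⁻¹ ≤ (T.card : ℝ)⁻¹ ^ k := by
        rw [← inv_pow]
        gcongr
      have h5 : (k : ℝ) / (2 * d ^ k) = 1 / 2 * ((d : ℝ) ^ k)⁻¹ * k := by field_simp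
      have h6 : 0 ≤ (T.card : ℝ)⁻¹ ^ k := by positivity
      have h7 : 1 / 2 * ((d : ℝ) ^ k)⁻¹ * k ≤
          (1 - (T.card : ℝ)⁻¹) * (T.card : ℝ)⁻¹ ^ k * k := by
        have h8 : 1 / 2 ≤ 1 - (T.card : ℝ)⁻¹ := by linarith
        have h9 : 0 ≤ 1 - (T.card : ℝ)⁻¹ := by linarith
        gcongr
      linarith
    -- With one generator `1 - p = 0`, but the first run succeeds surely.
    · have : T.card = 1 := le_antisymm h1 hT.card_pos
      simp only [this, Nat.cast_one, inv_one, one_pow]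
      rw [div_le_iff₀ (by positivity)]
      nlinarith
  linarith

end AvoidProb

/-! ### The Markov property and infinitely many hits -/

section RandomWalk

variable {S : Type*}

theorem countable_of_closure_eq_top [Monoid S] {T : Finset S}
    (hT : Submonoid.closure (T : Set S) = ⊤) : Countable S := by
  have : Function.Surjective fun l : List T => (l.map Subtype.val).prod := by
    intro x
    have hx : x ∈ Submonoid.closure (T : Set S) := hT ▸ Submonoid.mem_top x
    obtain ⟨l, hl, rfl⟩ := Submonoid.exists_list_of_mem_closure hx
    lift l to List T using hl
    exact ⟨l, rfl⟩
  exact this.countable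

variable [MeasurableSpace S] {Ω : Type*}

/-- The σ-algebra generated by `X 0, …, X (n - 1)`. -/
abbrev past (X : ℕ → Ω → S) (n : ℕ) : MeasurableSpace Ω :=
  ⨆ i ∈ Set.Iio n, MeasurableSpace.comap (X i) inferInstance

theorem past_mono (X : ℕ → Ω → S) : Monotone (past X) := fun _ _ h =>
  biSup_mono fun _ hi => lt_of_lt_of_le hi h

theorem measurable_past_of_lt (X : ℕ → Ω → S) {i n : ℕ} (h : i < n) :
    Measurable[past X n] (X i) :=
  measurable_iff_comap_le.2
    (le_iSup₂ (f := fun j (_ : j ∈ Set.Iio n) => MeasurableSpace.comap (X j) _) i h)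

theorem measurable_past_walk [Monoid S] {X R : ℕ → Ω → S} [Countable S] [DiscreteMeasurableSpace S]
    (h0 : ∀ ω, R 0 ω = 1) (hR : ∀ n ω, R (n + 1) ω = R n ω * X n ω)
    {m n : ℕ} (h : m ≤ n) : Measurable[past X n] (R m) := by
  induction m with
  | zero =>
    rw [show R 0 = fun _ => 1 from funext h0]
    exact measurable_const
  | succ m ih =>
    rw [show R (m + 1) = fun ω => (fun p : S × S => p.1 * p.2) (R m ω, X m ω) from
      funext (hR m)]
    have h1 : Measurable[past X n] (R m) := ih (by omega)
    have h2 : Measurable[past X n] (X m) := measurable_past_of_lt X h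
    have h3 : Measurable[past X n] fun ω => (R m ω, X m ω) := h1.prodMk h2
    exact (measurable_of_countable fun p : S × S => p.1 * p.2).comp h3

variable [MeasurableSpace Ω] {μ : Measure Ω} {X : ℕ → Ω → S}

theorem past_le (hX : ∀ i, Measurable (X i)) (n : ℕ) : past X n ≤ ‹MeasurableSpace Ω› :=
  iSup₂_le fun i _ => (hX i).comap_le

theorem indep_past (hX : ∀ i, Measurable (X i)) (hind : iIndepFun X μ) (n : ℕ) :
    Indep (past X n) (MeasurableSpace.comap (X n) inferInstance) μ := by
  have h := indep_iSup_of_disjoint (fun i => (hX i).comap_le) hind.iIndep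
    (S := Set.Iio n) (T := {n}) (by simp)
  simpa [past] using h

theorem measure_preimage_singleton_of_map_eq_uniformOn [DiscreteMeasurableSpace S] {T : Finset S}
    {Y : Ω → S} (hY : Measurable Y) (hlaw : μ.map Y = uniformOn (T : Set S)) {t : S} (ht : t ∈ T) :
    μ (Y ⁻¹' {t}) = ENNReal.ofReal (T.card : ℝ)⁻¹ := by
  have h0 : (0 : ℝ) < T.card := by exact_mod_cast Finset.card_pos.2 ⟨t, ht⟩
  rw [← Measure.map_apply hY (measurableSet_singleton t), hlaw, uniformOn,
    cond_apply T.measurableSet, Set.inter_eq_self_of_subset_right (by simpa using ht),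
    Measure.count_singleton, Measure.count_apply_finset, mul_one, ENNReal.ofReal_inv_of_pos h0,
    ENNReal.ofReal_natCast]

theorem ae_mem_of_map_eq_uniformOn [DiscreteMeasurableSpace S] {T : Finset S}
    {Y : Ω → S} (hY : Measurable Y) (hlaw : μ.map Y = uniformOn (T : Set S)) :
    ∀ᵐ ω ∂μ, Y ω ∈ T := by
  refine ae_of_ae_map hY.aemeasurable (p := fun s => s ∈ T) ?_
  rw [hlaw]
  exact ae_cond_mem T.measurableSet

variable [Monoid S] {R : ℕ → Ω → S}

variable {T : Finset S} {A : Set S}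

/-- The Markov property of the random walk. -/
theorem measure_inter_avoid [Countable S] [DiscreteMeasurableSpace S] [IsProbabilityMeasure μ]
    (hX : ∀ i, Measurable (X i)) (hind : iIndepFun X μ)
    (hlaw : ∀ i, μ.map (X i) = uniformOn (T : Set S))
    (h0 : ∀ ω, R 0 ω = 1) (hR : ∀ n ω, R (n + 1) ω = R n ω * X n ω)
    (L n : ℕ) {H : Set Ω} (hH : MeasurableSet[past X n] H) :
    μ (H ∩ {ω | ∀ i ≤ L, R (n + i) ω ∉ A}) =
      ∫⁻ ω in H, ENNReal.ofReal (avoidProb T A L (R n ω)) ∂μ := by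
  have hRn : ∀ n, Measurable[past X n] (R n) := fun n => measurable_past_walk h0 hR le_rfl
  have hAn : ∀ n, MeasurableSet[past X n] (R n ⁻¹' Aᶜ) := fun n => hRn n (.of_discrete)
  have hA : ∀ n, MeasurableSet (R n ⁻¹' Aᶜ) := fun n => past_le hX n _ (hAn n)
  have hout : ∀ (L n : ℕ) {H : Set Ω}, MeasurableSet H →
      ∫⁻ ω in H, ENNReal.ofReal (avoidProb T A L (R n ω)) ∂μ =
        ∫⁻ ω in H ∩ R n ⁻¹' Aᶜ, ENNReal.ofReal (avoidProb T A L (R n ω)) ∂μ := by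
    intro L n H hH
    rw [Set.inter_comm, ← Measure.restrict_restrict (hA n), ← lintegral_indicator (hA n)]
    refine lintegral_congr fun ω => ?_
    by_cases h : R n ω ∈ A
    · simp [avoidProb_of_mem h, Set.indicator]
    · simp [h, Set.indicator]
  induction L generalizing n H with
  | zero =>
    have hHm := past_le hX n _ hH
    rw [hout 0 n hHm, setLIntegral_congr_fun (g := fun _ => 1) (hHm.inter (hA n))]
    · simp [Set.preimage, Set.compl_def]
    · rintro ω ⟨-, hω⟩
      simp [avoidProb_zero_of_notMem (show R n ω ∉ A from hω)]
  | succ L ih =>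
    have hHm := past_le hX n _ hH
    have hH' : MeasurableSet[past X n] (H ∩ R n ⁻¹' Aᶜ) := hH.inter (hAn n)
    have hset : H ∩ {ω | ∀ i ≤ L + 1, R (n + i) ω ∉ A} =
        (H ∩ R n ⁻¹' Aᶜ) ∩ {ω | ∀ i ≤ L, R (n + 1 + i) ω ∉ A} := by
      ext ω
      constructor
      · rintro ⟨h1, h2⟩
        refine ⟨⟨h1, h2 0 (by omega)⟩, fun i hi => ?_⟩
        have := h2 (1 + i) (by omega)
        rwa [← add_assoc] at this
      · rintro ⟨⟨h1, h2⟩, h3⟩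
        refine ⟨h1, fun i hi => ?_⟩
        obtain _ | i := i
        · exact h2
        · have := h3 i (by omega)
          rwa [add_assoc, add_comm 1 i] at this
    rw [hset, ih (n + 1) (past_mono X (Nat.le_succ n) _ hH'), hout (L + 1) n hHm]
    set H' := H ∩ R n ⁻¹' Aᶜ
    have hHm' : MeasurableSet H' := past_le hX n _ hH'
    set f : S → Ω → ENNReal := fun t => H'.indicator fun ω =>
      ENNReal.ofReal (avoidProb T A L (R n ω * t)) with hf
    have hfn : ∀ t, Measurable[past X n] (f t) := fun t =>
      ((measurable_of_countable fun v => ENNReal.ofReal (avoidProb T A L (v * t))).comp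
        (hRn n)).indicator hH'
    have hfm : ∀ t, Measurable (f t) := fun t => (hfn t).mono (past_le hX n) le_rfl
    set g : S → Ω → ENNReal := fun t => (X n ⁻¹' {t}).indicator 1 with hg
    have hgn : ∀ t, Measurable[MeasurableSpace.comap (X n) inferInstance] (g t) := fun t =>
      Measurable.indicator (m := .comap (X n) inferInstance) measurable_const
        ⟨{t}, .of_discrete, rfl⟩
    have hgm : ∀ t, Measurable (g t) := fun t => (hgn t).mono (hX n).comap_le le_rfl
    -- Splitting by the value of `X n` gives products of a past-measurable factor and a function of
    -- `X n`, which independence factorizes.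
    have hleft : ∫⁻ ω in H', ENNReal.ofReal (avoidProb T A L (R (n + 1) ω)) ∂μ =
        ∫⁻ ω, ∑ t ∈ T, f t ω * g t ω ∂μ := by
      rw [← lintegral_indicator hHm']
      refine lintegral_congr_ae ?_
      filter_upwards [ae_mem_of_map_eq_uniformOn (hX n) (hlaw n)] with ω hω
      rw [Finset.sum_eq_single_of_mem _ hω]
      · simp [hf, hg, Set.indicator, hR]
      · intro t _ ht
        simp [hg, ht.symm]
    have hright : ∫⁻ ω in H', ENNReal.ofReal (avoidProb T A (L + 1) (R n ω)) ∂μ =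
        ∫⁻ ω, ∑ t ∈ T, f t ω * ENNReal.ofReal (T.card : ℝ)⁻¹ ∂μ := by
      rw [← lintegral_indicator hHm']
      refine lintegral_congr fun ω => ?_
      by_cases hω : ω ∈ H'
      · have hωA : R n ω ∉ A := hω.2
        simp only [hf, Set.indicator_of_mem hω, avoidProb_succ_of_notMem hωA]
        rw [mul_comm, ENNReal.ofReal_mul (Finset.sum_nonneg fun t _ => avoidProb_nonneg _ _),
          ENNReal.ofReal_sum_of_nonneg fun t _ => avoidProb_nonneg _ _, Finset.sum_mul]
      · simp [hf, hω]
    rw [hleft, hright, lintegral_finsetSum (f := fun t ω => f t ω * g t ω) _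
        fun t _ => (hfm t).mul (hgm t),
      lintegral_finsetSum _ fun t _ => (hfm t).mul_const _]
    refine Finset.sum_congr rfl fun t ht => ?_
    rw [lintegral_mul_eq_lintegral_mul_lintegral_of_independent_measurableSpace
      (past_le hX n) (hX n).comap_le (indep_past hX hind n) (hfn t) (hgn t),
      lintegral_mul_const _ (hfm t), hg, lintegral_indicator_one (hX n (.of_discrete)),
      measure_preimage_singleton_of_map_eq_uniformOn (hX n) (hlaw n) ht]

theorem measure_inter_avoid_le [Countable S] [DiscreteMeasurableSpace S] [IsProbabilityMeasure μ]
    (hX : ∀ i, Measurable (X i)) (hind : iIndepFun X μ)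
    (hlaw : ∀ i, μ.map (X i) = uniformOn (T : Set S))
    (h0 : ∀ ω, R 0 ω = 1) (hR : ∀ n ω, R (n + 1) ω = R n ω * X n ω)
    (L n : ℕ) {H : Set Ω} (hH : MeasurableSet[past X n] H) {c : ℝ}
    (hc : ∀ v, avoidProb T A L v ≤ c) :
    μ (H ∩ {ω | ∀ i ≤ L, R (n + i) ω ∉ A}) ≤ ENNReal.ofReal c * μ H := by
  rw [measure_inter_avoid hX hind hlaw h0 hR L n hH, ← setLIntegral_const]
  exact lintegral_mono fun ω => ENNReal.ofReal_le_ofReal (hc _)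

/-- If the walk avoids `A k` during the `k`-th block with conditional probability at most
`exp (-a k)`, and `∑ a k = ∞`, then almost surely it hits `A k` in infinitely many blocks. -/
theorem ae_frequently_hit [Countable S] [DiscreteMeasurableSpace S] [IsProbabilityMeasure μ]
    (hX : ∀ i, Measurable (X i)) (hind : iIndepFun X μ)
    (hlaw : ∀ i, μ.map (X i) = uniformOn (T : Set S))
    (h0 : ∀ ω, R 0 ω = 1) (hR : ∀ n ω, R (n + 1) ω = R n ω * X n ω)
    {A : ℕ → Set S} {L N : ℕ → ℕ} (hN : ∀ k, N (k + 1) = N k + L k) {a : ℕ → ℝ} {K₀ : ℕ}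
    (ha : ∀ k ≥ K₀, ∀ v, avoidProb T (A k) (L k) v ≤ Real.exp (-a k))
    (hdiv : ∀ K, Tendsto (fun m => ∑ k ∈ Finset.range m, a (K + k)) atTop atTop) :
    ∀ᵐ ω ∂μ, ∀ K ≥ K₀, ∃ k ≥ K, ∃ i ≤ L k, R (N k + i) ω ∈ A k := by
  refine ae_all_iff.2 fun K => ?_
  by_cases hK : K ≥ K₀
  swap
  · exact .of_forall fun ω h => absurd h hK
  have hmono : Monotone N := monotone_nat_of_le_succ fun k => by rw [hN]; omega
  set B : ℕ → Set Ω := fun k => {ω | ∀ i ≤ L k, R (N k + i) ω ∉ A k} with hB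
  have hBm : ∀ k n, N (k + 1) ≤ n → MeasurableSet[past X n] (B k) := by
    intro k n hn
    have : B k = ⋂ i ∈ Set.Iic (L k), R (N k + i) ⁻¹' (A k)ᶜ := by
      ext ω; simp [hB]
    rw [this]
    refine MeasurableSet.biInter (Set.to_countable _) fun i hi => ?_
    rw [hN] at hn
    have hi : i ≤ L k := hi
    exact measurable_past_walk h0 hR (by omega) (.of_discrete)
  have hH : ∀ m, MeasurableSet[past X (N (K + m))] (⋂ k ∈ Set.Iio m, B (K + k)) := fun m =>
    MeasurableSet.biInter (Set.to_countable _) fun k hk =>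
      hBm _ _ (hmono (by have : k < m := hk; omega))
  have hbound : ∀ m, μ (⋂ k ∈ Set.Iio m, B (K + k)) ≤
      ENNReal.ofReal (Real.exp (-∑ k ∈ Finset.range m, a (K + k))) := by
    intro m
    induction m with
    | zero => simp
    | succ m ih =>
      have hs : (⋂ k ∈ Set.Iio (m + 1), B (K + k)) =
          (⋂ k ∈ Set.Iio m, B (K + k)) ∩ B (K + m) := by
        ext ω
        simp only [Set.mem_iInter, Set.mem_Iio, Set.mem_inter_iff]
        constructor
        · exact fun h => ⟨fun k hk => h k (by omega), h m (by omega)⟩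
        · rintro ⟨h1, h2⟩ k hk
          rcases Nat.lt_succ_iff_lt_or_eq.1 hk with hk | rfl
          · exact h1 k hk
          · exact h2
      rw [hs, Finset.sum_range_succ, neg_add, Real.exp_add,
        mul_comm (Real.exp (-∑ k ∈ Finset.range m, a (K + k))),
        ENNReal.ofReal_mul (Real.exp_pos _).le]
      refine (measure_inter_avoid_le hX hind hlaw h0 hR _ _ (hH m)
        (ha (K + m) (by omega))).trans ?_
      gcongr
  have hzero : μ (⋂ k, B (K + k)) = 0 := by
    have hlim : Tendsto
        (fun m => ENNReal.ofReal (Real.exp (-∑ k ∈ Finset.range m, a (K + k)))) atTop (nhds 0) := by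
      rw [← ENNReal.ofReal_zero]
      exact ENNReal.tendsto_ofReal
        (Real.tendsto_exp_atBot.comp (tendsto_neg_atTop_atBot.comp (hdiv K)))
    refine le_antisymm (ge_of_tendsto' hlim fun m => (measure_mono ?_).trans (hbound m)) bot_le
    exact fun ω hω => Set.mem_iInter₂.2 fun k _ => Set.mem_iInter.1 hω k
  filter_upwards [measure_eq_zero_iff_ae_notMem.1 hzero] with ω hω _
  by_contra! hcon
  exact hω (Set.mem_iInter.2 fun k i hi => hcon _ (by omega) i hi)

end RandomWalk

/-! ### Block lengths and logarithms -/

section Blocks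

theorem eight_mul_sq_le_pow {d k : ℕ} (hd : 2 ≤ d) (hk : 10 ≤ k) : 8 * k ^ 2 ≤ d ^ k := by
  refine le_trans ?_ (Nat.pow_le_pow_left hd k)
  induction k, hk using Nat.le_induction with
  | base => norm_num
  | succ k hk ih => rw [pow_succ 2]; nlinarith

/-- The number of windows of length `2 * k` in the `k`-th block of times. -/
def numWindows (d k : ℕ) : ℕ := d ^ k / (8 * k ^ 2)

/-- The start of the `k`-th block of times. -/
def blockStart (d k : ℕ) : ℕ := ∑ i ∈ Finset.range k, 2 * i * numWindows d i

theorem blockStart_succ (d k : ℕ) :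
    blockStart d (k + 1) = blockStart d k + 2 * k * numWindows d k :=
  Finset.sum_range_succ _ _

theorem one_le_numWindows {d k : ℕ} (hd : 2 ≤ d) (hk : 10 ≤ k) : 1 ≤ numWindows d k :=
  (Nat.one_le_div_iff (by positivity)).2 (eight_mul_sq_le_pow hd hk)

theorem le_blockStart_add_ten {d : ℕ} (hd : 2 ≤ d) (k : ℕ) : k ≤ blockStart d k + 10 := by
  induction k with
  | zero => omega
  | succ k ih =>
    rw [blockStart_succ]
    rcases Nat.lt_or_ge k 10 with hk | hk
    · omega
    · have := one_le_numWindows hd hk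
      nlinarith

/-- Block `k` has length at most `dᵏ / (4k)`, so the next start is at most `5dᵏ / (4k)`. The bound
propagates because `5(k+1) ≤ 8k` and `2 ≤ d`. -/
theorem blockStart_mul_le {d k : ℕ} (hd : 2 ≤ d) (hk : 2 ≤ k) : blockStart d k * k ≤ d ^ k := by
  induction k, hk using Nat.le_induction with
  | base =>
    simp only [blockStart, numWindows, Finset.sum_range_succ, Finset.sum_range_zero]
    have : d / 8 * 8 ≤ d := Nat.div_mul_le_self d 8
    norm_num
    nlinarith
  | succ k hk ih =>
    have h1 : numWindows d k * (8 * k ^ 2) ≤ d ^ k := Nat.div_mul_le_self _ _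
    have h2 : 4 * k * blockStart d (k + 1) ≤ 5 * d ^ k := by
      rw [blockStart_succ]; nlinarith
    have h3 : 5 * (k + 1) * blockStart d (k + 1) ≤ 8 * k * blockStart d (k + 1) :=
      Nat.mul_le_mul_right _ (by omega)
    have h4 : 2 * d ^ k ≤ d ^ (k + 1) := by
      rw [pow_succ']; exact Nat.mul_le_mul_right _ hd
    nlinarith

theorem logb_add_logb_logb_lt {d n k : ℕ} (hd : 2 ≤ d) (hn : 2 ≤ n) (hk : 1 ≤ k)
    (h : n * (k + 1) ≤ d ^ (k + 1)) :
    Real.logb d n + Real.logb d (Real.logb d n) < k + 1 := by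
  have hd1 : (1 : ℝ) < d := by exact_mod_cast (by omega : 1 < d)
  have hn1 : (1 : ℝ) < n := by exact_mod_cast (by omega : 1 < n)
  have h' : (n : ℝ) * (k + 1) ≤ (d : ℝ) ^ (k + 1) := by exact_mod_cast h
  have hpos : 0 < Real.logb d n := Real.logb_pos hd1 hn1
  have h1 : Real.logb d n + Real.logb d (k + 1) ≤ k + 1 := by
    rw [← Real.logb_mul (by positivity) (by positivity)]
    refine (Real.logb_le_logb_of_le hd1 (by positivity) h').trans (le_of_eq ?_)
    rw [Real.logb_pow, Real.logb_self_eq_one hd1]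
    push_cast; ring
  have h2 : Real.logb d n < k + 1 := by
    rw [Real.logb_lt_iff_lt_rpow hd1 (by positivity)]
    have e : (d : ℝ) ^ ((k : ℝ) + 1) = (d : ℝ) ^ (k + 1) := by
      rw [← Real.rpow_natCast]; push_cast; rfl
    rw [e]
    have : (1 : ℝ) ≤ k := by exact_mod_cast hk
    nlinarith
  have h3 := Real.logb_lt_logb hd1 hpos h2
  linarith

theorem tendsto_sum_inv_atTop (K : ℕ) :
    Tendsto (fun m => ∑ k ∈ Finset.range m, 1 / (32 * ((K + k : ℕ) : ℝ))) atTop atTop := by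
  rw [← not_summable_iff_tendsto_nat_atTop_of_nonneg fun k => by positivity]
  intro h
  refine Real.not_summable_one_div_natCast ((summable_nat_add_iff K).1 ?_)
  refine (h.mul_left 32).congr fun k => ?_
  rw [add_comm K k]
  ring

variable {S : Type*} [Monoid S] {T : Finset S} {A : Set S}

theorem avoidProb_block_le (hT : T.Nonempty) {d : ℕ} (hd : 2 ≤ d) (hTd : T.card ≤ d) {k : ℕ}
    (hk : 10 ≤ k) (hA : ∀ v, ∃ w ∈ A, ∃ j ≤ k, HasWalk (cayleyDigraph T) j v w) (v : S) :
    avoidProb T A (2 * k * numWindows d k) v ≤ Real.exp (-(1 / (32 * (k : ℝ)))) := by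
  have hexp : ∀ v, avoidProb T A (2 * k) v ≤ Real.exp (-(k / (2 * d ^ k))) := fun v =>
    (avoidProb_two_mul_le hT hd hTd hA v).trans (Real.one_sub_le_exp_neg _)
  refine (avoidProb_mul_le hexp _ v).trans ?_
  rw [← Real.exp_nat_mul, Real.exp_le_exp, mul_neg, neg_le_neg_iff]
  have hk0 : (0 : ℝ) < k := by exact_mod_cast (by omega : 0 < k)
  have hd0 : (0 : ℝ) < d := by exact_mod_cast (by omega : 0 < d)
  have h1 : 1 ≤ numWindows d k := one_le_numWindows hd hk
  have h2 : d ^ k < (numWindows d k + 1) * (8 * k ^ 2) :=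
    Nat.lt_mul_of_div_lt (Nat.lt_succ_self _) (by positivity)
  -- Rounding down a quotient that is at least 1 costs at most a factor 2.
  have h3 : d ^ k ≤ numWindows d k * (16 * k ^ 2) := by nlinarith
  have h4 : (d : ℝ) ^ k ≤ numWindows d k * (16 * k ^ 2) := by exact_mod_cast h3
  rw [← mul_div_assoc, div_le_div_iff₀ (by positivity) (by positivity)]
  nlinarith

end Blocks

end RootedBallSpread

/-! ### The main theorem -/

open RootedBallSpread in
theorem corollaryD {S : Type*} [Monoid S] [MeasurableSpace S] [DiscreteMeasurableSpace S]
    (d : ℕ) (hd : 2 ≤ d)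
    (T : Finset S) (hTcard : T.card ≤ d) (hTgen : Submonoid.closure (T : Set S) = ⊤)
    (hS : ∀ I : Set S, RootedBallSpread.IsRightIdeal I → I.Infinite)
    {Ω : Type*} [MeasurableSpace Ω] (μ : Measure Ω) [IsProbabilityMeasure μ]
    (R : ℕ → Ω → S) (hR : RootedBallSpread.IsSimpleRightRandomWalk T μ R) :
    ∀ᵐ ω ∂μ, {n : ℕ | RootedBallSpread.semigroupSpread T
        (Real.logb d n + Real.logb d (Real.logb d n)) ≤
          RootedBallSpread.wordLength T (R n ω)}.Infinite := by
  obtain ⟨X, hX, hind, hlaw, h0, hR⟩ := hR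
  have : Countable S := countable_of_closure_eq_top hTgen
  have hT : T.Nonempty := by
    obtain ⟨ω, hω⟩ := (ae_mem_of_map_eq_uniformOn (hX 0) (hlaw 0)).exists
    exact ⟨_, hω⟩
  have hG : ∀ v, {w | (cayleyDigraph T).Adj v w}.Finite := fun v => by
    refine ((T.finite_toSet).image (v * ·)).subset ?_
    rintro w ⟨t, ht, rfl⟩
    exact ⟨t, ht, rfl⟩
  have hhit := ae_frequently_hit (A := fun k : ℕ => {w | semigroupSpread T k ≤ wordLength T w})
    (L := fun k => 2 * k * numWindows d k) (N := blockStart d) (K₀ := 10)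
    (a := fun k => 1 / (32 * (k : ℝ))) hX hind hlaw h0 hR (blockStart_succ d)
    (fun k hk v => avoidProb_block_le hT hd hTcard hk
      (fun v => exists_hasWalk_spread_le hG 1 v k) v)
    tendsto_sum_inv_atTop
  filter_upwards [hhit] with ω hω
  refine Set.infinite_of_not_bddAbove fun ⟨m, hm⟩ => ?_
  -- Since block `k` starts no earlier than `k - 10`, the offset 13 makes the hitting time at least
  -- `m + 3`: beyond `m`, and at least 2 as the logarithms require.
  obtain ⟨k, hk, i, hi, hki⟩ := hω (m + 13) (by omega)
  have h1 := le_blockStart_add_ten hd k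
  have h2 : blockStart d k + i ≤ blockStart d (k + 1) := by
    rw [blockStart_succ]; omega
  have h3 : (blockStart d k + i) * (k + 1) ≤ d ^ (k + 1) :=
    (Nat.mul_le_mul_right _ h2).trans (blockStart_mul_le hd (by omega))
  have h4 := hm (a := blockStart d k + i) <|
    (spread_le_of_lt_add_one 1 (logb_add_logb_logb_lt hd (by omega) (by omega) h3)).trans hki
  omega
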